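/- **Definitions.** For a polynomial $p\in\mathbb C[X]$ let $P$ be the unique polynomial with $\sum_{\nu=1}^n p(\nu)=P(n)$ for all $n\in\mathbb N$, and put $\overset{\leftrightarrow}{\sum}_{\nu=\alpha}^{\beta}p(\nu):=P(\beta)-P(\alpha-1)$ for $\alpha,\beta\in\mathbb C$. Let $U\subset\mathbb C$. A function $f\colon U\to\mathbb C$ is an *approximate polynomial of degree* $\sigma\in\mathbb N\cup\{-\infty\}$ if $U+1\subset U$ and there are polynomials $(p_n)_{n\in\mathbb N}$, all of degree $\sigma$, with $|f(n+u)-p_n(n+u)|\to0$ as $n\to\infty$ for every $u\in U$. It is *right summable* if it is an approximate polynomial of some degree and, for all $\alpha,\beta$ with $\alpha,\beta+1\in U$, the limit $$\overset{\to}{\sum_{\nu=\alpha}^{\beta}}f(\nu):=\lim_{n\to\infty}\Bigl(\overset{\leftrightarrow}{\sum_{\nu=n+\alpha}^{n+\beta}}p_n(\nu)+\sum_{\nu=1}^n\bigl(f(\nu+\alpha-1)-f(\nu+\beta)\bigr)\Bigr)$$ exists, with a value that does not depend on the choice of $\sigma$ and of the approximating polynomials $p_n$; this value is the *(right) fractional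 sum* of $f$ from $\alpha$ to $\beta$. For $w\in\mathbb C\setminus\{0,-1,-2,\dots\}$, the Hurwitz zeta function $s\mapsto\zeta(s,w)$ is the holomorphic function on $\mathbb C\setminus\{1\}$ that equals $\sum_{\nu=0}^\infty(\nu+w)^{-s}$ for $\operatorname{Re}s>1$. All powers $z^c$ ($z\ne0$) are $e^{c\log z}$ with the branch $\operatorname{Im}\log z\in(-\pi,\pi]$, and $\zeta(s)$ is the Riemann zeta function. **Corollary (Extended Riemann–Hurwitz $\zeta$ Formula).** Let $x\in\mathbb C\setminus\{-1,-2,-3,\dots\}$ and $a\in\mathbb C\setminus\{-1\}$. Then the holomorphic function $s\mapsto\zeta(s,x+1)$ on $\mathbb C\setminus\{1\}$ just described exists, the function $\nu\mapsto\nu^a$ on $U=\mathbb C\setminus\{0,-1,-2,\dots\}$ is right summable, and its fractional sum from $1$ to $x$ is $$\overset{\to}{\sum_{\nu=1}^{x}}\nu^a=\zeta(-a)-\zeta(-a,x+1).$$ -/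

import Mathlib

open Polynomial Filter Topology

/-- Every polynomial `p` has a unique summation polynomial `P`, characterised by
`p(1) + ⋯ + p(n) = P(n)` for all natural numbers `n`. -/
theorem existsUnique_summationPolynomial (p : ℂ[X]) :
    ∃! P : ℂ[X], ∀ n : ℕ, ∑ ν ∈ Finset.Icc 1 n, p.eval (ν : ℂ) = P.eval (n : ℂ) := by
  have hex : ∃ Q : ℂ[X], ∀ n : ℕ, ∑ ν ∈ Finset.range n, p.eval (ν : ℂ) = Q.eval (n : ℂ) := by
    induction p using Polynomial.induction_on' with
    | add p q hp hq =>
      obtain ⟨P, hP⟩ := hp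
      obtain ⟨Q, hQ⟩ := hq
      exact ⟨P + Q, fun n => by simp [Finset.sum_add_distrib, hP, hQ]⟩
    | monomial k c =>
      refine ⟨C (c / (k + 1)) * ((Polynomial.bernoulli (k + 1)).map (algebraMap ℚ ℂ)
        - C ((_root_.bernoulli (k + 1) : ℚ) : ℂ)), fun n => ?_⟩
      have h := Polynomial.bernoulli_succ_eval n k
      have h' : ((Polynomial.bernoulli (k + 1)).map (algebraMap ℚ ℂ)).eval (n : ℂ)
          = ((_root_.bernoulli (k + 1) : ℚ) : ℂ)
            + ((k : ℂ) + 1) * ∑ ν ∈ Finset.range n, (ν : ℂ) ^ k := by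
        have h2 := congrArg (algebraMap ℚ ℂ) h
        rw [← Polynomial.eval_map_apply] at h2
        simpa using h2
      have hk : (k : ℂ) + 1 ≠ 0 := Nat.cast_add_one_ne_zero k
      simp only [eval_monomial, eval_mul, eval_C, eval_sub, h', add_sub_cancel_left]
      rw [← Finset.mul_sum]
      field_simp
  obtain ⟨Q, hQ⟩ := hex
  refine ⟨Q.comp (X + 1) - C (p.eval 0), fun n => ?_, fun P hP => ?_⟩
  · have h := hQ (n + 1)
    rw [Finset.sum_range_succ'] at h
    have h3 : ∑ ν ∈ Finset.Icc 1 n, p.eval (ν : ℂ)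
        = ∑ ν ∈ Finset.range n, p.eval ((ν + 1 : ℕ) : ℂ) := by
      rw [Finset.range_eq_Ico, Finset.sum_Ico_add' (fun j : ℕ => p.eval (j : ℂ)) 0 n 1]
      rfl
    rw [h3]
    simp only [eval_sub, eval_comp, eval_add, eval_X, eval_one, eval_C]
    push_cast at h ⊢
    rw [← h]
    ring
  · refine Polynomial.eq_of_infinite_eval_eq _ _
      ((Set.infinite_range_of_injective (Nat.cast_injective (R := ℂ))).mono ?_)
    rintro _ ⟨n, rfl⟩
    have h := hQ (n + 1)
    rw [Finset.sum_range_succ'] at h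
    have h3 : ∑ ν ∈ Finset.Icc 1 n, p.eval (ν : ℂ)
        = ∑ ν ∈ Finset.range n, p.eval ((ν + 1 : ℕ) : ℂ) := by
      rw [Finset.range_eq_Ico, Finset.sum_Ico_add' (fun j : ℕ => p.eval (j : ℂ)) 0 n 1]
      rfl
    simp only [Set.mem_ofPred_eq, eval_sub, eval_comp, eval_add, eval_X, eval_one, eval_C]
    rw [← hP n, h3]
    push_cast at h ⊢
    rw [← h]
    ring

/-- The summation polynomial `P` of `p`: the polynomial with `∑_{ν=1}^n p(ν) = P(n)`
for all natural numbers `n`. -/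
noncomputable def summationPolynomial (p : ℂ[X]) : ℂ[X] :=
  (existsUnique_summationPolynomial p).choose

/-- The fractional sum `∑_{ν=a}^b p(ν) = P(b) - P(a - 1)` of a polynomial `p`, for complex
boundaries `a`, `b`. -/
noncomputable def polynomialFracSum (p : ℂ[X]) (a b : ℂ) : ℂ :=
  (summationPolynomial p).eval b - (summationPolynomial p).eval (a - 1)

/-- `p` is a sequence of polynomials of fixed degree `σ` (an element of `ℕ ∪ {-∞}`, where `-∞` is
the degree of the zero polynomial) with `|f(n + x) - p_n(n + x)| → 0` for every `x ∈ U`. -/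
def IsApproximatingSeq (f : ℂ → ℂ) (U : Set ℂ) (σ : WithBot ℕ) (p : ℕ → ℂ[X]) : Prop :=
  (∀ n, (p n).degree = σ) ∧
    ∀ x ∈ U, Tendsto (fun n : ℕ => ‖f (n + x) - (p n).eval ((n : ℂ) + x)‖) atTop (𝓝 0)

/-- `f`, regarded as a function on `U`, is a (right) approximate polynomial of degree `σ`. -/
def IsApproximatePolynomial (f : ℂ → ℂ) (U : Set ℂ) (σ : WithBot ℕ) : Prop :=
  (∀ u ∈ U, u + 1 ∈ U) ∧ ∃ p : ℕ → ℂ[X], IsApproximatingSeq f U σ p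

/-- The sequence whose limit is the fractional sum of `f` from `a` to `b`, formed with the
approximating polynomials `p`. -/
noncomputable def fracSumSeq (p : ℕ → ℂ[X]) (f : ℂ → ℂ) (a b : ℂ) (n : ℕ) : ℂ :=
  polynomialFracSum (p n) (n + a) (n + b)
    + ∑ ν ∈ Finset.Icc 1 n, (f ((ν : ℂ) + a - 1) - f ((ν : ℂ) + b))

/-- Whatever approximating polynomials of `f` on `U` are used, the limit in the definition of the
fractional sum of `f` from `a` to `b` exists and equals `L`. -/
def FracSumTendsto (f : ℂ → ℂ) (U : Set ℂ) (a b L : ℂ) : Prop :=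
  ∀ (σ : WithBot ℕ) (p : ℕ → ℂ[X]), IsApproximatingSeq f U σ p →
    Tendsto (fracSumSeq p f a b) atTop (𝓝 L)

/-- `f`, regarded as a function on `U`, is right summable: it is an approximate polynomial, and
the limit in the definition of the fractional sum exists for all `a, b + 1 ∈ U`. -/
def IsRightSummable (f : ℂ → ℂ) (U : Set ℂ) : Prop :=
  (∃ σ : WithBot ℕ, IsApproximatePolynomial f U σ) ∧
    ∀ a b : ℂ, a ∈ U → b + 1 ∈ U → ∃ L : ℂ, FracSumTendsto f U a b L

/-- The (right) fractional sum of `f : U → ℂ` from `a` to `b` exists and equals `L`. -/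
def HasRightFracSum (f : ℂ → ℂ) (U : Set ℂ) (a b L : ℂ) : Prop :=
  IsRightSummable f U ∧ a ∈ U ∧ b + 1 ∈ U ∧ FracSumTendsto f U a b L

/-- `Z` is the Hurwitz zeta function `s ↦ ζ(s, x)`: it is holomorphic on `ℂ ∖ {1}` and given by
`∑_{ν ≥ 0} 1 / (ν + x)^s` for `Re s > 1`. Complex powers use the logarithm with imaginary part in
`(-π, π]`, i.e. continuous from above on the negative reals. -/
def IsHurwitzZeta (x : ℂ) (Z : ℂ → ℂ) : Prop :=
  DifferentiableOn ℂ Z {1}ᶜ ∧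
    ∀ s : ℂ, 1 < s.re → HasSum (fun ν : ℕ => 1 / ((ν : ℂ) + x) ^ s) (Z s)

/-- The properties defining `s ↦ ζ(s, x)` determine it on `ℂ ∖ {1}`. -/
theorem IsHurwitzZeta.eqOn {x : ℂ} {Z W : ℂ → ℂ} (hZ : IsHurwitzZeta x Z)
    (hW : IsHurwitzZeta x W) : Set.EqOn Z W {1}ᶜ := by
  have hconn : IsPreconnected ({1}ᶜ : Set ℂ) :=
    (isConnected_compl_singleton_of_one_lt_rank (by simp) (1 : ℂ)).isPreconnected
  have hopen : IsOpen ({1}ᶜ : Set ℂ) := isOpen_compl_singleton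
  refine (hZ.1.analyticOnNhd hopen).eqOn_of_preconnected_of_eventuallyEq
    (hW.1.analyticOnNhd hopen) hconn (z₀ := 2) (by simp) ?_
  have hev : ∀ᶠ s : ℂ in 𝓝 2, 1 < s.re :=
    Complex.continuous_re.continuousAt.eventually (lt_mem_nhds (by norm_num))
  filter_upwards [hev] with s hs
  exact (hZ.2 s hs).unique (hW.2 s hs)

/-- The Hurwitz zeta function `ζ(s, x)` with complex second argument
`x ∉ {0, -1, -2, …}`, continued in `s` to `ℂ ∖ {1}`. -/
noncomputable def complexHurwitzZeta (s x : ℂ) : ℂ :=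
  Classical.epsilon (IsHurwitzZeta x) s

/-!
The fractional sum of `ν ↦ ν ^ a` from `1` to `x` is studied as a function of the exponent `a`.

After a shift by `n`, the Taylor polynomial `cpowTaylor K a n` of `Y ↦ (n + Y) ^ a` of degree less
than `K` approximates `(n + y) ^ a` up to `O(n ^ (re a - K))`, uniformly for `a` in a ball
(`norm_cpow_sub_cpowTaylor_le`, a tail estimate for the binomial series). Fractional sums of
polynomials are linear, compatible with shifts, and, in bounded degree, determined by finitely many
values through Lagrange interpolation (`exists_polynomialFracSum_eq_sum_eval`). Hence the increments
of the sequence `cpowFracSumSeq` defining the fractional sum are fixed linear combinations of Taylor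
remainders (`cpowFracSumSeq_succ_sub`). The sequence therefore converges locally uniformly in `a`,
and its limit `cpowFracSumLimit x a` is an entire function of `a`
(`differentiable_cpowFracSumLimit`).

For `re a < -1` the polynomial part disappears in the limit, and the limit is
`∑ (ν + 1) ^ a - ∑ (ν + 1 + x) ^ a`. So `s ↦ ζ(s) - cpowFracSumLimit x (-s)` is holomorphic away
from `1` and equals `∑ (ν + x + 1) ^ (-s)` for `re s > 1`: it is the Hurwitz zeta function
(`isHurwitzZeta_sub_cpowFracSumLimit`). This yields its existence and the formula at the same time,
by uniqueness of analytic continuation.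

Finally, any other approximating polynomials of fixed degree differ from the Taylor polynomials by
polynomials of bounded degree tending to `0` at each positive integer, and by interpolation this
does not change the limit (`fracSumTendsto_cpow_one`). General boundaries reduce to sums from `1`
(`fracSumSeq_eq_sub`).
-/

/-! ### Fractional sums of polynomials -/

theorem summationPolynomial_spec (p : ℂ[X]) (n : ℕ) :
    ∑ ν ∈ Finset.Icc 1 n, p.eval (ν : ℂ) = (summationPolynomial p).eval (n : ℂ) :=
  (existsUnique_summationPolynomial p).choose_spec.1 n

theorem eq_summationPolynomial {p P : ℂ[X]}
    (h : ∀ n : ℕ, ∑ ν ∈ Finset.Icc 1 n, p.eval (ν : ℂ) = P.eval (n : ℂ)) :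
    summationPolynomial p = P :=
  (existsUnique_summationPolynomial p).unique (summationPolynomial_spec p) h

/-- A polynomial is the summation polynomial of `p` as soon as it vanishes at `0` and its
differences at the natural numbers are the values of `p`. -/
theorem eq_summationPolynomial_of_sub {p P : ℂ[X]} (h0 : P.eval 0 = 0)
    (h : ∀ n : ℕ, P.eval ((n : ℂ) + 1) - P.eval (n : ℂ) = p.eval ((n : ℂ) + 1)) :
    summationPolynomial p = P := by
  refine eq_summationPolynomial fun n => ?_
  induction n with
  | zero => simp [h0]
  | succ n ih =>
    rw [Finset.sum_Icc_succ_top (by omega), ih]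
    push_cast
    rw [← h n]
    ring

/-- The telescoping rule for `summationPolynomial` at an arbitrary complex point: both sides are
polynomials in `z` that agree at the natural numbers. -/
theorem summationPolynomial_eval_add_one (p : ℂ[X]) (z : ℂ) :
    (summationPolynomial p).eval (z + 1)
      = (summationPolynomial p).eval z + p.eval (z + 1) := by
  have h : (summationPolynomial p).comp (X + 1) = summationPolynomial p + p.comp (X + 1) := by
    refine Polynomial.eq_of_infinite_eval_eq _ _
      ((Set.infinite_range_of_injective (Nat.cast_injective (R := ℂ))).mono ?_)
    rintro _ ⟨n, rfl⟩
    have h1 := summationPolynomial_spec p n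
    have h2 := summationPolynomial_spec p (n + 1)
    rw [Finset.sum_Icc_succ_top (by omega), h1] at h2
    push_cast at h2
    simpa using h2.symm
  simpa using congrArg (Polynomial.eval z) h

theorem polynomialFracSum_add (p q : ℂ[X]) (α β : ℂ) :
    polynomialFracSum (p + q) α β = polynomialFracSum p α β + polynomialFracSum q α β := by
  have h : summationPolynomial (p + q) = summationPolynomial p + summationPolynomial q :=
    eq_summationPolynomial fun n => by
      simp [Finset.sum_add_distrib, summationPolynomial_spec]
  simp only [polynomialFracSum, h, eval_add]
  ring

theorem polynomialFracSum_C_mul (c : ℂ) (p : ℂ[X]) (α β : ℂ) :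
    polynomialFracSum (C c * p) α β = c * polynomialFracSum p α β := by
  have h : summationPolynomial (C c * p) = C c * summationPolynomial p :=
    eq_summationPolynomial fun n => by
      simp [← Finset.mul_sum, summationPolynomial_spec]
  simp only [polynomialFracSum, h, eval_mul, eval_C]
  ring

/-- The fractional sum between fixed boundaries, as a linear functional on polynomials. -/
noncomputable def polynomialFracSumLinear (α β : ℂ) : ℂ[X] →ₗ[ℂ] ℂ where
  toFun p := polynomialFracSum p α β
  map_add' p q := polynomialFracSum_add p q α β
  map_smul' c p := by simp [smul_eq_C_mul, polynomialFracSum_C_mul]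

theorem polynomialFracSum_sub (p q : ℂ[X]) (α β : ℂ) :
    polynomialFracSum (p - q) α β = polynomialFracSum p α β - polynomialFracSum q α β :=
  map_sub (polynomialFracSumLinear α β) p q

theorem polynomialFracSum_sum {ι : Type*} (s : Finset ι) (p : ι → ℂ[X]) (α β : ℂ) :
    polynomialFracSum (∑ i ∈ s, p i) α β = ∑ i ∈ s, polynomialFracSum (p i) α β :=
  map_sum (polynomialFracSumLinear α β) p s

theorem polynomialFracSum_comp_X_add_C (p : ℂ[X]) (c α β : ℂ) :
    polynomialFracSum (p.comp (X + C c)) α β = polynomialFracSum p (α + c) (β + c) := by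
  have h : summationPolynomial (p.comp (X + C c))
      = (summationPolynomial p).comp (X + C c) - C ((summationPolynomial p).eval c) := by
    refine eq_summationPolynomial_of_sub (by simp) fun n => ?_
    have := summationPolynomial_eval_add_one p (n + c)
    simp only [eval_sub, eval_comp, eval_add, eval_X, eval_C]
    rw [add_right_comm, this]
    ring
  simp only [polynomialFracSum, h, eval_sub, eval_comp, eval_add, eval_X, eval_C]
  rw [show α - 1 + c = α + c - 1 by ring]
  ring

/-- Moving both boundaries by one adds the summand at the top and drops the one at the bottom. -/
theorem polynomialFracSum_add_one (p : ℂ[X]) (α β : ℂ) :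
    polynomialFracSum p (α + 1) (β + 1)
      = polynomialFracSum p α β + p.eval (β + 1) - p.eval α := by
  have h1 := summationPolynomial_eval_add_one p β
  have h2 := summationPolynomial_eval_add_one p (α - 1)
  rw [sub_add_cancel] at h2
  simp only [polynomialFracSum, h1, add_sub_cancel_right, h2]
  ring

/-- On polynomials of degree less than `D` the fractional sum is a linear combination of the values
at `1, …, D`, by Lagrange interpolation. -/
theorem exists_polynomialFracSum_eq_sum_eval (D : ℕ) (α β : ℂ) :
    ∃ c : ℕ → ℂ, ∀ r : ℂ[X], r.degree < D →
      polynomialFracSum r α β = ∑ j ∈ Finset.range D, c j * r.eval ((j : ℂ) + 1) := by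
  refine ⟨fun j => polynomialFracSum
    (Lagrange.basis (Finset.range D) (fun i : ℕ => (i : ℂ) + 1) j) α β, fun r hr => ?_⟩
  have hinj : Set.InjOn (fun i : ℕ => (i : ℂ) + 1) (Finset.range D) := fun i _ j _ hij => by
    simpa using hij
  conv_lhs =>
    rw [Lagrange.eq_interpolate (f := r) hinj (by simpa using hr), Lagrange.interpolate_apply]
  simp only [polynomialFracSum_sum, polynomialFracSum_C_mul]
  exact Finset.sum_congr rfl fun j _ => mul_comm _ _

/-- Polynomials of bounded degree that tend to `0` at `1, 2, 3, …` have fractional sums tending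
to `0`. This makes fractional sums independent of the approximating polynomials. -/
theorem tendsto_polynomialFracSum_zero {D : ℕ} {r : ℕ → ℂ[X]} (hr : ∀ n, (r n).degree < D)
    (h : ∀ j : ℕ, Tendsto (fun n => (r n).eval ((j : ℂ) + 1)) atTop (𝓝 0)) (α β : ℂ) :
    Tendsto (fun n => polynomialFracSum (r n) α β) atTop (𝓝 0) := by
  obtain ⟨c, hc⟩ := exists_polynomialFracSum_eq_sum_eval D α β
  simp only [fun n => hc (r n) (hr n)]
  simpa using tendsto_finsetSum (Finset.range D) fun j _ => (h j).const_mul (c j)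

/-- Reduces general boundaries to sums that start at `1`. -/
theorem fracSumSeq_eq_sub (p : ℕ → ℂ[X]) (f : ℂ → ℂ) (α β : ℂ) (n : ℕ) :
    fracSumSeq p f α β n = fracSumSeq p f 1 β n - fracSumSeq p f 1 (α - 1) n := by
  simp only [fracSumSeq, polynomialFracSum, Finset.sum_sub_distrib]
  simp only [add_sub_assoc]
  ring

/-- Shifting the approximating polynomials turns the moving boundaries into fixed ones. -/
theorem fracSumSeq_one (p : ℕ → ℂ[X]) (f : ℂ → ℂ) (x : ℂ) (n : ℕ) :
    fracSumSeq p f 1 x n = polynomialFracSum ((p n).comp (X + C (n : ℂ))) 1 x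
      + ∑ ν ∈ Finset.Icc 1 n, (f ν - f (ν + x)) := by
  rw [polynomialFracSum_comp_X_add_C, fracSumSeq, add_comm 1, add_comm x]
  simp

/-! ### The binomial series -/

theorem succ_mul_choose_succ (a : ℂ) (k : ℕ) :
    ((k : ℂ) + 1) * Ring.choose a (k + 1) = (a - k) * Ring.choose a k := by
  have h := Ring.choose_smul_choose a (Nat.le_succ k)
  simp only [Nat.succ_eq_add_one, Nat.choose_succ_self_right, nsmul_eq_mul, Nat.cast_add,
    Nat.cast_one, add_tsub_cancel_left, Ring.choose_one_right] at h
  rw [h, mul_comm]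

theorem choose_succ_eq (a : ℂ) (k : ℕ) :
    Ring.choose a (k + 1) = (a - k) * Ring.choose a k / ((k : ℂ) + 1) := by
  rw [← succ_mul_choose_succ, mul_div_cancel_left₀ _ (Nat.cast_add_one_ne_zero k)]

theorem differentiable_choose (k : ℕ) : Differentiable ℂ fun a : ℂ => Ring.choose a k := by
  induction k with
  | zero => simp
  | succ k ih =>
    simp only [choose_succ_eq]
    fun_prop

theorem norm_choose_le {a : ℂ} {M : ℝ} (hM : 1 ≤ M) (ha : ‖a‖ ≤ M) (k : ℕ) :
    ‖Ring.choose a k‖ ≤ M ^ k := by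
  induction k with
  | zero => simp
  | succ k ih =>
    have hk : ‖(k : ℂ) + 1‖ = (k : ℝ) + 1 := by
      rw [← Nat.cast_add_one, Complex.norm_natCast]; simp
    have h1 : ‖a - k‖ ≤ M * (k + 1) := by
      have := norm_sub_le a (k : ℂ)
      rw [Complex.norm_natCast] at this
      nlinarith [(Nat.cast_nonneg k : (0 : ℝ) ≤ k)]
    rw [choose_succ_eq, norm_div, norm_mul, hk, div_le_iff₀ (by positivity)]
    calc ‖a - k‖ * ‖Ring.choose a k‖ ≤ (M * (k + 1)) * M ^ k := by gcongr
      _ = M ^ (k + 1) * (k + 1) := by ring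

theorem hasSum_choose_mul_pow (a : ℂ) {z : ℂ} (hz : ‖z‖ < 1) :
    HasSum (fun k : ℕ => Ring.choose a k * z ^ k) ((1 + z) ^ a) := by
  have h := (Complex.one_add_cpow_hasFPowerSeriesOnBall_zero (a := a)).hasSum (y := z) (by
    rw [← ENNReal.ofReal_one, Metric.eball_ofReal]; simpa using hz)
  simpa [binomialSeries, FormalMultilinearSeries.coeff_ofScalars, mul_comm] using h

/-- The remainder of the binomial series, with a bound uniform in the exponent `a` for `‖a‖ ≤ M`:
it is dominated by a geometric series of ratio `M * ‖z‖ ≤ 1 / 2`. -/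
theorem norm_one_add_cpow_sub_le {a z : ℂ} {M : ℝ} (hM : 1 ≤ M) (ha : ‖a‖ ≤ M)
    (hz : M * ‖z‖ ≤ 1 / 2) (K : ℕ) :
    ‖(1 + z) ^ a - ∑ k ∈ Finset.range K, Ring.choose a k * z ^ k‖ ≤ 2 * (M * ‖z‖) ^ K := by
  have hz1 : ‖z‖ < 1 := by nlinarith [norm_nonneg z]
  have hpos : 0 ≤ M * ‖z‖ := by positivity
  have h := (hasSum_nat_add_iff' K).2 (hasSum_choose_mul_pow a hz1)
  have hgeo : HasSum (fun k : ℕ => (M * ‖z‖) ^ K * (M * ‖z‖) ^ k)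
      ((M * ‖z‖) ^ K * (1 - M * ‖z‖)⁻¹) :=
    (hasSum_geometric_of_lt_one hpos (by linarith)).mul_left _
  refine (h.norm_le_of_bounded hgeo fun k => ?_).trans ?_
  · rw [norm_mul, norm_pow, ← pow_add, add_comm K, mul_pow]
    gcongr
    exact norm_choose_le hM ha _
  · rw [mul_comm]
    gcongr
    rw [inv_le_comm₀ (by linarith) (by norm_num)]
    linarith

/-- The Taylor polynomial of degree less than `K` of `Y ↦ (n + Y) ^ a` at `Y = 0`. For `n = 0` the
powers `0 ^ (a - k)` make it a junk value; only large `n` matter. -/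
noncomputable def cpowTaylor (K : ℕ) (a : ℂ) (n : ℕ) : ℂ[X] :=
  ∑ k ∈ Finset.range K, C (Ring.choose a k * (n : ℂ) ^ (a - k)) * X ^ k

theorem cpowTaylor_eval (K : ℕ) (a : ℂ) (n : ℕ) (y : ℂ) :
    (cpowTaylor K a n).eval y
      = ∑ k ∈ Finset.range K, Ring.choose a k * (n : ℂ) ^ (a - k) * y ^ k := by
  simp [cpowTaylor, eval_finsetSum]

theorem cpowTaylor_degree_lt (K : ℕ) (a : ℂ) (n : ℕ) : (cpowTaylor K a n).degree < K := by
  refine (degree_sum_le _ _).trans_lt ((Finset.sup_lt_iff (WithBot.bot_lt_coe K)).2 fun k hk => ?_)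
  exact (degree_C_mul_X_pow_le _ _).trans_lt (WithBot.coe_lt_coe.2 (Finset.mem_range.1 hk))

theorem norm_cpow_sub_cpowTaylor_le {a y : ℂ} {M : ℝ} (hM : 1 ≤ M) (ha : ‖a‖ ≤ M) (K : ℕ) {n : ℕ}
    (hn : 0 < n) (hy : 2 * (M * ‖y‖) ≤ n) :
    ‖((n : ℂ) + y) ^ a - (cpowTaylor K a n).eval y‖
      ≤ 2 * (M * ‖y‖) ^ K * (n : ℝ) ^ (a.re - K) := by
  have hnR : (0 : ℝ) < n := by exact_mod_cast hn
  have hnC : (n : ℂ) ≠ 0 := by exact_mod_cast hn.ne'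
  have hnorm : ‖y / (n : ℂ)‖ = ‖y‖ / n := by simp
  have hz : M * ‖y / (n : ℂ)‖ ≤ 1 / 2 := by
    rw [hnorm, ← mul_div_assoc, div_le_iff₀ hnR]
    linarith
  have hne : 1 + y / (n : ℂ) ≠ 0 := by
    intro h0
    have h1 : y / (n : ℂ) = -1 := by linear_combination h0
    rw [h1, norm_neg, norm_one] at hz
    linarith
  -- No branch jump occurs here: `n` is a positive real number.
  have hfac : ((n : ℂ) + y) ^ a = (n : ℂ) ^ a * (1 + y / n) ^ a := by
    have h1 : (n : ℂ) + y = ((n : ℝ) : ℂ) * (1 + y / n) := by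
      push_cast
      field_simp
    have hne' : ((n : ℝ) : ℂ) ≠ 0 := by simpa using hnC
    rw [h1, Complex.cpow_def_of_ne_zero (mul_ne_zero hne' hne), Complex.log_ofReal_mul hnR hne,
      Complex.cpow_def_of_ne_zero hnC, Complex.cpow_def_of_ne_zero hne, ← Complex.exp_add,
      Complex.natCast_log]
    ring_nf
  have hsum : (cpowTaylor K a n).eval y
      = (n : ℂ) ^ a * ∑ k ∈ Finset.range K, Ring.choose a k * (y / n) ^ k := by
    rw [cpowTaylor_eval, Finset.mul_sum]
    refine Finset.sum_congr rfl fun k _ => ?_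
    rw [Complex.cpow_sub _ _ hnC, Complex.cpow_natCast, div_pow]
    field_simp
  rw [hfac, hsum, ← mul_sub, norm_mul, Complex.norm_natCast_cpow_of_pos hn,
    Real.rpow_sub hnR, Real.rpow_natCast]
  refine (mul_le_mul_of_nonneg_left (norm_one_add_cpow_sub_le hM ha hz K) (by positivity)).trans
    (le_of_eq ?_)
  rw [hnorm, ← mul_div_assoc, div_pow]
  field_simp

/-! ### The limit as a function of the exponent -/

/-- The sequence whose limit is the fractional sum of `ν ↦ ν ^ a` from `1` to `x`, formed with the
Taylor polynomials of degree less than `K` and written with fixed boundaries. -/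
noncomputable def cpowFracSumSeq (K : ℕ) (x : ℂ) (n : ℕ) (a : ℂ) : ℂ :=
  polynomialFracSum (cpowTaylor K a n) 1 x
    + ∑ ν ∈ Finset.Icc 1 n, ((ν : ℂ) ^ a - ((ν : ℂ) + x) ^ a)

theorem polynomialFracSum_cpowTaylor (K : ℕ) (a : ℂ) (n : ℕ) (α β : ℂ) :
    polynomialFracSum (cpowTaylor K a n) α β = ∑ k ∈ Finset.range K,
      Ring.choose a k * (n : ℂ) ^ (a - k) * polynomialFracSum (X ^ k) α β := by
  simp only [cpowTaylor, polynomialFracSum_sum, polynomialFracSum_C_mul]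

theorem differentiable_cpowFracSumSeq (K : ℕ) {x : ℂ} (hx : ∀ k : ℕ, x ≠ -((k : ℂ) + 1)) {n : ℕ}
    (hn : n ≠ 0) : Differentiable ℂ (cpowFracSumSeq K x n) := by
  unfold cpowFracSumSeq
  simp only [polynomialFracSum_cpowTaylor]
  refine .add (.fun_sum fun k _ => .mul_const (.mul (differentiable_choose k) ?_) _)
    (.fun_sum fun ν hν => .sub ?_ ?_)
  · exact (differentiable_id.sub_const _).const_cpow (.inl (by exact_mod_cast hn))
  · have hν1 : ν ≠ 0 := by have := (Finset.mem_Icc.1 hν).1; omega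
    exact differentiable_id.const_cpow (.inl (by exact_mod_cast hν1))
  · refine differentiable_id.const_cpow (.inl fun h0 => ?_)
    obtain ⟨m, rfl⟩ : ∃ m, ν = m + 1 :=
      ⟨ν - 1, by have := (Finset.mem_Icc.1 hν).1; omega⟩
    refine hx m ?_
    push_cast at h0
    linear_combination h0

/-- The increments of `cpowFracSumSeq` only involve Taylor remainders: the polynomial in the first
term is the difference of two Taylor polynomials of the same function. -/
theorem cpowFracSumSeq_succ_sub (K : ℕ) (x : ℂ) (n : ℕ) (a : ℂ) :
    cpowFracSumSeq K x (n + 1) a - cpowFracSumSeq K x n a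
      = polynomialFracSum (cpowTaylor K a (n + 1) - (cpowTaylor K a n).comp (X + C 1)) 1 x
        + ((((n : ℂ) + 1) ^ a - (cpowTaylor K a n).eval 1)
          - (((n : ℂ) + (x + 1)) ^ a - (cpowTaylor K a n).eval (x + 1))) := by
  rw [polynomialFracSum_sub, polynomialFracSum_comp_X_add_C, polynomialFracSum_add_one,
    cpowFracSumSeq, cpowFracSumSeq, Finset.sum_Icc_succ_top (by omega)]
  push_cast
  rw [show (n : ℂ) + (x + 1) = n + 1 + x by ring]
  ring

/-- The Taylor remainder is `O(n⁻²)`, uniformly in the exponent. The principal filter of the ball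
expresses the uniformity. -/
theorem isBigO_cpow_sub_cpowTaylor {M : ℝ} (hM : 1 ≤ M) {K : ℕ} (hK : M + 2 ≤ K) (y : ℂ) :
    (fun q : ℕ × ℂ => ((q.1 : ℂ) + y) ^ q.2 - (cpowTaylor K q.2 q.1).eval y)
      =O[atTop ×ˢ 𝓟 (Metric.ball 0 M)] fun q => ((q.1 : ℝ) ^ 2)⁻¹ := by
  refine Asymptotics.IsBigO.of_bound (2 * (M * ‖y‖) ^ K) ?_
  rw [eventually_prod_principal_iff]
  have hev : ∀ᶠ n : ℕ in atTop, 2 * (M * ‖y‖) ≤ n :=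
    tendsto_natCast_atTop_atTop.eventually_ge_atTop _
  filter_upwards [hev, eventually_ge_atTop 1] with n hn hn1 a ha
  have ha' : ‖a‖ ≤ M := (mem_ball_zero_iff.1 ha).le
  refine (norm_cpow_sub_cpowTaylor_le hM ha' K hn1 hn).trans ?_
  have h1 : (1 : ℝ) ≤ n := by exact_mod_cast hn1
  have h2 : (n : ℝ) ^ (a.re - K) ≤ ((n : ℝ) ^ 2)⁻¹ := by
    rw [← Real.rpow_natCast, ← Real.rpow_neg (by linarith)]
    refine Real.rpow_le_rpow_of_exponent_le h1 ?_
    have := a.re_le_norm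
    push_cast
    linarith
  rw [Real.norm_of_nonneg (by positivity)]
  gcongr

/-- The increments of `cpowFracSumSeq` are `O(n⁻²)`, uniformly in the exponent: they are a fixed
linear combination of Taylor remainders, by Lagrange interpolation. -/
theorem isBigO_cpowFracSumSeq_succ_sub {M : ℝ} (hM : 1 ≤ M) {K : ℕ} (hK : M + 2 ≤ K) (x : ℂ) :
    (fun q : ℕ × ℂ => cpowFracSumSeq K x (q.1 + 1) q.2 - cpowFracSumSeq K x q.1 q.2)
      =O[atTop ×ˢ 𝓟 (Metric.ball 0 M)] fun q => ((q.1 : ℝ) ^ 2)⁻¹ := by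
  have herr := isBigO_cpow_sub_cpowTaylor hM hK
  have hshift : ∀ y : ℂ, (fun q : ℕ × ℂ =>
      (((q.1 + 1 : ℕ) : ℂ) + y) ^ q.2 - (cpowTaylor K q.2 (q.1 + 1)).eval y)
      =O[atTop ×ˢ 𝓟 (Metric.ball 0 M)] fun q => ((q.1 : ℝ) ^ 2)⁻¹ := fun y => by
    have htend : Tendsto (fun q : ℕ × ℂ => (q.1 + 1, q.2)) (atTop ×ˢ 𝓟 (Metric.ball 0 M))
        (atTop ×ˢ 𝓟 (Metric.ball 0 M)) :=
      (tendsto_add_atTop_nat 1).prodMap tendsto_id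
    refine ((herr y).comp_tendsto htend).trans (.of_bound 1 ?_)
    rw [eventually_prod_principal_iff]
    filter_upwards [eventually_ge_atTop 1] with n hn a _
    have h1 : (1 : ℝ) ≤ n := by exact_mod_cast hn
    simp only [Function.comp_apply, one_mul]
    rw [Real.norm_of_nonneg (by positivity), Real.norm_of_nonneg (by positivity)]
    gcongr
    omega
  obtain ⟨c, hc⟩ := exists_polynomialFracSum_eq_sum_eval K 1 x
  have hpoly : (fun q : ℕ × ℂ => polynomialFracSum
      (cpowTaylor K q.2 (q.1 + 1) - (cpowTaylor K q.2 q.1).comp (X + C 1)) 1 x)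
      =O[atTop ×ˢ 𝓟 (Metric.ball 0 M)] fun q => ((q.1 : ℝ) ^ 2)⁻¹ := by
    have hdeg : ∀ q : ℕ × ℂ,
        (cpowTaylor K q.2 (q.1 + 1) - (cpowTaylor K q.2 q.1).comp (X + C 1)).degree < K :=
      fun q => (degree_sub_le _ _).trans_lt (max_lt (cpowTaylor_degree_lt _ _ _) (by
        rw [← taylor_apply, degree_taylor]
        exact cpowTaylor_degree_lt _ _ _))
    simp only [fun q => hc _ (hdeg q)]
    refine .fun_sum fun j _ => .const_mul_left (.congr_left
      ((herr ((j : ℂ) + 1 + 1)).sub (hshift ((j : ℂ) + 1))) fun q => ?_) _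
    simp only [eval_sub, eval_comp, eval_add, eval_X, eval_C]
    push_cast
    rw [show (q.1 : ℂ) + (j + 1 + 1) = q.1 + 1 + (j + 1) by ring]
    ring
  exact (hpoly.add ((herr 1).sub (herr (x + 1)))).congr_left fun q =>
    (cpowFracSumSeq_succ_sub K x q.1 q.2).symm

/-- The sequence `cpowFracSumSeq` converges to a holomorphic function of the exponent, being a
partial sum of a normally convergent series of holomorphic functions. -/
theorem exists_differentiableOn_limit {x : ℂ} (hx : ∀ k : ℕ, x ≠ -((k : ℂ) + 1)) {M : ℝ}
    (hM : 1 ≤ M) {K : ℕ} (hK : M + 2 ≤ K) :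
    ∃ F : ℂ → ℂ, DifferentiableOn ℂ F (Metric.ball 0 M) ∧
      ∀ a ∈ Metric.ball (0 : ℂ) M, Tendsto (fun n => cpowFracSumSeq K x n a) atTop (𝓝 (F a)) := by
  obtain ⟨c, hc⟩ := (isBigO_cpowFracSumSeq_succ_sub hM hK x).bound
  rw [eventually_prod_principal_iff] at hc
  obtain ⟨N, hN⟩ := eventually_atTop.1 (hc.and (eventually_ge_atTop 1))
  set G : ℕ → ℂ → ℂ := fun m a =>
    cpowFracSumSeq K x (m + N + 1) a - cpowFracSumSeq K x (m + N) a with hG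
  have hu : Summable fun m : ℕ => c * (((m + N : ℕ) : ℝ) ^ 2)⁻¹ :=
    ((summable_nat_add_iff N).2 (Real.summable_nat_pow_inv.2 one_lt_two)).mul_left c
  have hbound : ∀ m a, a ∈ Metric.ball (0 : ℂ) M → ‖G m a‖ ≤ c * (((m + N : ℕ) : ℝ) ^ 2)⁻¹ :=
    fun m a ha => by
      have := (hN (m + N) (by omega)).1 a ha
      rwa [Real.norm_of_nonneg (by positivity)] at this
  have hd : ∀ n, N ≤ n → Differentiable ℂ (cpowFracSumSeq K x n) := fun n hn =>
    differentiable_cpowFracSumSeq K hx (by have := (hN n hn).2; omega)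
  refine ⟨fun a => cpowFracSumSeq K x N a + ∑' m, G m a, ?_, fun a ha => ?_⟩
  · exact (hd N le_rfl).differentiableOn.add (Complex.differentiableOn_tsum_of_summable_norm hu
      (fun m => ((hd _ (by omega)).sub (hd _ (by omega))).differentiableOn)
      Metric.isOpen_ball hbound)
  · have hs : Summable fun m => G m a := .of_norm_bounded hu fun m => hbound m a ha
    rw [← tendsto_add_atTop_iff_nat N]
    refine (hs.hasSum.tendsto_sum_nat.const_add (cpowFracSumSeq K x N a)).congr fun n => ?_
    have := Finset.sum_range_sub (fun m => cpowFracSumSeq K x (m + N) a) n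
    simp only [hG, zero_add, add_right_comm _ 1 N] at this ⊢
    rw [this]
    ring

theorem tendsto_natCast_cpow_sub_zero {a : ℂ} {K : ℕ} (hK : a.re < K) :
    Tendsto (fun n : ℕ => (n : ℂ) ^ (a - K)) atTop (𝓝 0) := by
  have h : Tendsto (fun n : ℕ => (n : ℝ) ^ (-(K - a.re))) atTop (𝓝 0) :=
    (tendsto_rpow_neg_atTop (sub_pos.2 hK)).comp tendsto_natCast_atTop_atTop
  refine squeeze_zero_norm' ?_ h
  filter_upwards [eventually_ge_atTop 1] with n hn
  rw [Complex.norm_natCast_cpow_of_pos hn]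
  simp

/-- The limit of `cpowFracSumSeq` does not depend on the degree of the Taylor polynomials, as soon
as this degree is large compared with the real part of the exponent. -/
theorem tendsto_cpowFracSumSeq_of_tendsto {a x l : ℂ} {K K' : ℕ} (hK : a.re < K) (hK' : a.re < K')
    (h : Tendsto (fun n => cpowFracSumSeq K x n a) atTop (𝓝 l)) :
    Tendsto (fun n => cpowFracSumSeq K' x n a) atTop (𝓝 l) := by
  have hterm : ∀ k : ℕ, a.re < k → Tendsto (fun n : ℕ =>
      Ring.choose a k * (n : ℂ) ^ (a - k) * polynomialFracSum (X ^ k) 1 x) atTop (𝓝 0) :=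
    fun k hk => by
      simpa using ((tendsto_natCast_cpow_sub_zero hk).const_mul (Ring.choose a k)).mul_const _
  -- Passing from `k` to `k + 1` adds a single term, which tends to `0`.
  have hstep : ∀ k : ℕ, a.re < k →
      (Tendsto (fun n => cpowFracSumSeq (k + 1) x n a) atTop (𝓝 l) ↔
        Tendsto (fun n => cpowFracSumSeq k x n a) atTop (𝓝 l)) := fun k hk => by
    have heq : ∀ n, cpowFracSumSeq (k + 1) x n a = cpowFracSumSeq k x n a
        + Ring.choose a k * (n : ℂ) ^ (a - k) * polynomialFracSum (X ^ k) 1 x := fun n => by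
      simp only [cpowFracSumSeq, polynomialFracSum_cpowTaylor, Finset.sum_range_succ]
      ring
    exact ⟨fun h => by simpa [heq] using h.sub (hterm k hk),
      fun h => by simpa [heq] using h.add (hterm k hk)⟩
  have hall : ∀ m : ℕ, ∀ k : ℕ, a.re < k →
      (Tendsto (fun n => cpowFracSumSeq (k + m) x n a) atTop (𝓝 l) ↔
        Tendsto (fun n => cpowFracSumSeq k x n a) atTop (𝓝 l)) := fun m k hk => by
    induction m with
    | zero => rfl
    | succ m ih =>
      rw [← ih]
      exact hstep (k + m) (by push_cast; linarith [(Nat.cast_nonneg m : (0 : ℝ) ≤ m)])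
  rw [← hall K K' hK', add_comm]
  exact (hall K' K hK).2 h

/-- The limit of `cpowFracSumSeq`, as a function of the exponent `a`. Taylor polynomials of degree
at most `⌈max (re a) 0⌉` are used; any larger degree gives the same limit. -/
noncomputable def cpowFracSumLimit (x a : ℂ) : ℂ :=
  limUnder atTop fun n => cpowFracSumSeq (⌈a.re⌉₊ + 1) x n a

theorem cpowFracSumLimit_eq_of_tendsto {a x l : ℂ} {K : ℕ} (hK : a.re < K)
    (h : Tendsto (fun n => cpowFracSumSeq K x n a) atTop (𝓝 l)) : cpowFracSumLimit x a = l := by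
  refine (tendsto_cpowFracSumSeq_of_tendsto hK ?_ h).limUnder_eq
  push_cast
  linarith [Nat.le_ceil a.re]

theorem tendsto_cpowFracSumSeq {x : ℂ} (hx : ∀ k : ℕ, x ≠ -((k : ℂ) + 1)) {a : ℂ} {K : ℕ}
    (hK : a.re < K) :
    Tendsto (fun n => cpowFracSumSeq K x n a) atTop (𝓝 (cpowFracSumLimit x a)) := by
  obtain ⟨K', hK'⟩ := exists_nat_ge (‖a‖ + 1 + 2)
  obtain ⟨F, -, hF⟩ := exists_differentiableOn_limit hx
    (by linarith [norm_nonneg a] : 1 ≤ ‖a‖ + 1) hK'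
  have h := hF a (by simp)
  have hre : a.re < K' := by linarith [a.re_le_norm]
  rw [cpowFracSumLimit_eq_of_tendsto hre h]
  exact tendsto_cpowFracSumSeq_of_tendsto hre hK h

theorem differentiable_cpowFracSumLimit {x : ℂ} (hx : ∀ k : ℕ, x ≠ -((k : ℂ) + 1)) :
    Differentiable ℂ (cpowFracSumLimit x) := fun a => by
  obtain ⟨K, hK⟩ := exists_nat_ge (‖a‖ + 1 + 2)
  obtain ⟨F, hFd, hF⟩ := exists_differentiableOn_limit hx
    (by linarith [norm_nonneg a] : 1 ≤ ‖a‖ + 1) hK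
  have hnhds : Metric.ball (0 : ℂ) (‖a‖ + 1) ∈ 𝓝 a := Metric.isOpen_ball.mem_nhds (by simp)
  refine (hFd.differentiableAt hnhds).congr_of_eventuallyEq ?_
  filter_upwards [hnhds] with b hb
  have hb' := mem_ball_zero_iff.1 hb
  exact cpowFracSumLimit_eq_of_tendsto (by linarith [b.re_le_norm]) (hF b hb)

/-! ### The Hurwitz zeta function -/

theorem summable_natCast_add_one_add_cpow {a : ℂ} (ha : a.re < -1) (x : ℂ) :
    Summable fun ν : ℕ => ((ν : ℂ) + 1 + x) ^ a := by
  set M : ℝ := max 1 ‖a‖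
  have hev : ∀ᶠ n : ℕ in atTop, 2 * (M * ‖x‖) ≤ n :=
    tendsto_natCast_atTop_atTop.eventually_ge_atTop _
  have hs : Summable fun ν : ℕ => ((ν : ℂ) + x) ^ a := by
    refine .of_norm_bounded_eventually_nat (g := fun n => 2 * (n : ℝ) ^ a.re)
      ((Real.summable_nat_rpow.2 ha).mul_left 2) ?_
    filter_upwards [hev, eventually_ge_atTop 1] with n hn hn1
    -- For `K = 0` the Taylor polynomial vanishes and the remainder bound is a growth bound.
    simpa [cpowTaylor] using
      norm_cpow_sub_cpowTaylor_le (le_max_left 1 ‖a‖) (le_max_right 1 ‖a‖) 0 hn1 hn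
  simpa using (summable_nat_add_iff 1).2 hs

/-- In the half-plane of convergence the polynomial part plays no role, and the fractional sum is
the difference of two convergent series. -/
theorem cpowFracSumLimit_eq_of_re_lt {a x : ℂ} (ha : a.re < -1) :
    cpowFracSumLimit x a = ∑' ν : ℕ, ((ν : ℂ) + 1) ^ a - ∑' ν : ℕ, ((ν : ℂ) + 1 + x) ^ a := by
  have h0 : Summable fun ν : ℕ => ((ν : ℂ) + 1) ^ a := by
    simpa using summable_natCast_add_one_add_cpow ha 0
  refine cpowFracSumLimit_eq_of_tendsto (K := 0) (by simp; linarith) ?_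
  refine (h0.hasSum.sub (summable_natCast_add_one_add_cpow ha x).hasSum).tendsto_sum_nat.congr
    fun n => ?_
  simp only [cpowFracSumSeq, polynomialFracSum_cpowTaylor, Finset.range_zero, Finset.sum_empty,
    zero_add]
  rw [Finset.range_eq_Ico, ← Finset.Ico_add_one_right_eq_Icc]
  simpa using
    Finset.sum_Ico_add' (fun ν : ℕ => (ν : ℂ) ^ a - ((ν : ℂ) + x) ^ a) 0 n 1

/-- The analytic continuation of the Hurwitz zeta function: the fractional sum is entire in its
exponent, so subtracting it from `riemannZeta` leaves a function holomorphic away from `1`. -/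
theorem isHurwitzZeta_sub_cpowFracSumLimit {x : ℂ} (hx : ∀ k : ℕ, x ≠ -((k : ℂ) + 1)) :
    IsHurwitzZeta (x + 1) fun s => riemannZeta s - cpowFracSumLimit x (-s) := by
  refine ⟨fun s hs => ?_, fun s hs => ?_⟩
  · exact ((differentiableAt_riemannZeta hs).sub
      ((differentiable_cpowFracSumLimit hx).comp differentiable_neg s)).differentiableWithinAt
  · have hre : (-s).re < -1 := by simpa using hs
    have h := (summable_natCast_add_one_add_cpow hre x).hasSum
    have hz : riemannZeta s = ∑' ν : ℕ, ((ν : ℂ) + 1) ^ (-s) := by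
      simp [zeta_eq_tsum_one_div_nat_add_one_cpow hs, Complex.cpow_neg]
    dsimp only
    rw [cpowFracSumLimit_eq_of_re_lt hre, hz, sub_sub_cancel]
    simpa [Complex.cpow_neg, add_assoc, add_comm, add_left_comm] using h

theorem isHurwitzZeta_complexHurwitzZeta {x : ℂ} (hx : ∀ k : ℕ, x ≠ -((k : ℂ) + 1)) :
    IsHurwitzZeta (x + 1) fun s => complexHurwitzZeta s (x + 1) :=
  Classical.epsilon_spec ⟨_, isHurwitzZeta_sub_cpowFracSumLimit hx⟩

/-! ### Arbitrary approximating polynomials -/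

theorem tendsto_cpow_sub_cpowTaylor {a : ℂ} {K : ℕ} (hK : a.re < K) (y : ℂ) :
    Tendsto (fun n : ℕ => ((n : ℂ) + y) ^ a - (cpowTaylor K a n).eval y) atTop (𝓝 0) := by
  set M : ℝ := max 1 ‖a‖
  have hev : ∀ᶠ n : ℕ in atTop, 2 * (M * ‖y‖) ≤ n :=
    tendsto_natCast_atTop_atTop.eventually_ge_atTop _
  have hlim : Tendsto (fun n : ℕ => 2 * (M * ‖y‖) ^ K * ‖(n : ℂ) ^ (a - K)‖) atTop (𝓝 0) := by
    simpa using (tendsto_natCast_cpow_sub_zero hK).norm.const_mul (2 * (M * ‖y‖) ^ K)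
  refine squeeze_zero_norm' ?_ hlim
  filter_upwards [hev, eventually_ge_atTop 1] with n hn hn1
  rw [Complex.norm_natCast_cpow_of_pos hn1]
  simpa using norm_cpow_sub_cpowTaylor_le (le_max_left 1 ‖a‖) (le_max_right 1 ‖a‖) K hn1 hn

/-- Taylor polynomials approximate `z ↦ z ^ a`. The extra term `X ^ K / (n + 1)` makes their degree
equal to `K` even where binomial coefficients vanish. -/
theorem isApproximatePolynomial_cpow {a : ℂ} {K : ℕ} (hK : a.re < K) :
    IsApproximatePolynomial (fun z : ℂ => z ^ a) {z : ℂ | ∀ k : ℕ, z ≠ -(k : ℂ)} K := by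
  refine ⟨fun u hu k hk => hu (k + 1) (by push_cast; linear_combination hk),
    fun n => (cpowTaylor K a n + C ((n : ℂ) + 1)⁻¹ * X ^ K).comp (X + C (-(n : ℂ))),
    fun n => ?_, fun y _ => ?_⟩
  · have hc : ((n : ℂ) + 1)⁻¹ ≠ 0 := inv_ne_zero (Nat.cast_add_one_ne_zero n)
    dsimp only
    rw [← taylor_apply, degree_taylor, degree_add_eq_right_of_degree_lt] <;>
      rw [degree_C_mul_X_pow K hc]
    exact cpowTaylor_degree_lt K a n
  · have h1 : Tendsto (fun n : ℕ => ((n : ℂ) + 1)⁻¹) atTop (𝓝 0) := by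
      simpa using tendsto_one_div_add_atTop_nhds_zero_nat (𝕜 := ℂ)
    have h := ((tendsto_cpow_sub_cpowTaylor hK y).sub (h1.mul_const (y ^ K))).norm
    simp only [zero_mul, sub_zero, norm_zero] at h
    refine h.congr fun n => ?_
    simp [sub_sub]

/-- Every approximating sequence gives the limit obtained from Taylor polynomials: after shifting by
`n`, the difference of the polynomials has bounded degree and tends to `0` at `1, 2, 3, …`. -/
theorem fracSumTendsto_cpow_one {x : ℂ} (hx : ∀ k : ℕ, x ≠ -((k : ℂ) + 1)) (a : ℂ) :
    FracSumTendsto (fun z : ℂ => z ^ a) {z : ℂ | ∀ k : ℕ, z ≠ -(k : ℂ)} 1 x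
      (cpowFracSumLimit x a) := by
  intro σ p ⟨hdeg, happ⟩
  obtain ⟨K, hK⟩ := exists_nat_gt a.re
  obtain ⟨D, hKD, hσD⟩ : ∃ D : ℕ, K ≤ D ∧ σ < D := by
    induction σ using WithBot.recBotCoe with
    | bot => exact ⟨K, le_rfl, WithBot.bot_lt_coe K⟩
    | coe m => exact ⟨max K (m + 1), le_max_left _ _, 
        WithBot.coe_lt_coe.2 ((Nat.lt_succ_self m).trans_le (le_max_right _ _))⟩
  have hr := tendsto_polynomialFracSum_zero (D := D)
    (r := fun n => (p n).comp (X + C (n : ℂ)) - cpowTaylor K a n)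
    (fun n => (degree_sub_le _ _).trans_lt (max_lt
      (by rw [← taylor_apply, degree_taylor, hdeg n]; exact hσD)
      ((cpowTaylor_degree_lt K a n).trans_le (by exact_mod_cast hKD))))
    (fun j => by
      have hj : (j : ℂ) + 1 ∈ {z : ℂ | ∀ k : ℕ, z ≠ -(k : ℂ)} := fun k hk => by
        have : ((j + 1 + k : ℕ) : ℂ) = 0 := by push_cast; linear_combination hk
        exact absurd (Nat.cast_eq_zero.1 this) (by omega)
      have h1 := tendsto_zero_iff_norm_tendsto_zero.2 (happ _ hj)
      have h2 := (tendsto_cpow_sub_cpowTaylor hK ((j : ℂ) + 1)).sub h1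
      rw [sub_zero] at h2
      refine h2.congr fun n => ?_
      simp only [eval_sub, eval_comp, eval_add, eval_X, eval_C]
      rw [add_comm ((j : ℂ) + 1)]
      ring) 1 x
  have hlim := hr.add (tendsto_cpowFracSumSeq hx hK)
  rw [zero_add] at hlim
  refine hlim.congr fun n => ?_
  rw [fracSumSeq_one, polynomialFracSum_sub, cpowFracSumSeq]
  ring

theorem isRightSummable_cpow (a : ℂ) :
    IsRightSummable (fun z : ℂ => z ^ a) {z : ℂ | ∀ k : ℕ, z ≠ -(k : ℂ)} := by
  obtain ⟨K, hK⟩ := exists_nat_gt a.re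
  refine ⟨⟨K, isApproximatePolynomial_cpow hK⟩, fun α β hα hβ =>
    ⟨cpowFracSumLimit β a - cpowFracSumLimit (α - 1) a, fun σ p hp => ?_⟩⟩
  have h1 := fracSumTendsto_cpow_one (x := β)
    (fun k hk => hβ k (by linear_combination hk)) a σ p hp
  have h2 := fracSumTendsto_cpow_one (x := α - 1)
    (fun k hk => hα k (by linear_combination hk)) a σ p hp
  exact (h1.sub h2).congr fun n => (fracSumSeq_eq_sub p _ α β n).symm

theorem mainTheorem5 (a x : ℂ) (ha : a ≠ -1) (hx : ∀ k : ℕ, x ≠ -((k : ℂ) + 1)) :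
    IsHurwitzZeta (x + 1) (fun s => complexHurwitzZeta s (x + 1)) ∧
    HasRightFracSum (fun z : ℂ => z ^ a) {z : ℂ | ∀ k : ℕ, z ≠ -(k : ℂ)} 1 x
      (riemannZeta (-a) - complexHurwitzZeta (-a) (x + 1)) := by
  have hZ := isHurwitzZeta_complexHurwitzZeta hx
  refine ⟨hZ, isRightSummable_cpow a, fun k hk => ?_,
    fun k hk => hx k (by linear_combination hk), ?_⟩
  · have : ((1 + k : ℕ) : ℂ) = 0 := by push_cast; linear_combination hk
    exact absurd (Nat.cast_eq_zero.1 this) (by omega)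
  · have hval : complexHurwitzZeta (-a) (x + 1) = riemannZeta (-a) - cpowFracSumLimit x a := by
      have hmem : -a ∈ ({1}ᶜ : Set ℂ) := fun h => ha (by
        rw [← neg_neg a, Set.mem_singleton_iff.1 h])
      simpa using hZ.eqOn (isHurwitzZeta_sub_cpowFracSumLimit hx) hmem
    rw [hval, sub_sub_cancel]
    exact fracSumTendsto_cpow_one hx a
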